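/- Let $\Lambda=\mathbb Z[t^{\pm1}]$. A quandle is a set with an operation $\triangleright$ such that $x\triangleright x=x$, each translation $\beta_y(x)=x\triangleright y$ is a permutation, and $(w\triangleright x)\triangleright y=(w\triangleright y)\triangleright(x\triangleright y)$; it is medial if $(w\triangleright x)\triangleright(y\triangleright z)=(w\triangleright y)\triangleright(x\triangleright z)$ always holds. If $M$ is a $\Lambda$-module, $N\subseteq M$ a submodule, $I$ a nonempty set, $m_i\in M$ $(i\in I)$ with $m_i-m_j\in N$ for all $i,j$, and $X_i\subseteq N$ are submodules with $(1-t)X_i=0$, then $Q(N,(m_i),(X_i))$ denotes the quandle whose underlying set is the disjoint union of the sets $Q_i=N/X_i$ and in which $x\triangleright y=m_j-m_i+tx+(1-t)y+X_i\in Q_i$ for $x\in Q_i$, $y\in Q_j$. Let $L=K_1\cup\dots\cup K_\mu$ $(\mu\ge1)$ be an oriented virtual link, with diagram $D$, set of arcs $A(D)$ (the curves are cut at the underpasses of the classical crossings) and set of classical crossings $C(D)$. For an arc $a$ let $\kappa(a)=i$ if $a$ belongs to $K_i$. At $c\in C(D)$ let $w(c)=\pm1$ be the writhe, $a(c)$ the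 overpassing arc, and $b_1(c)$, $b_2(c)$ the underpassing arcs on the right and on the left of $a(c)$, respectively. The medial quandle $\mathrm{MQ}(L)$ is the medial quandle generated by elements $q_a$ $(a\in A(D))$ subject to the relations $q_{b_2(c)}=q_{b_1(c)}\triangleright q_{a(c)}$ $(c\in C(D))$. The involutory medial quandle $\mathrm{IMQ}(L)$ is its involutory quotient, i.e. the quandle with a generator $x_{\mathrm{inv}}$ for each $x\in \mathrm{MQ}(L)$ and the relations $x_{\mathrm{inv}}\triangleright y_{\mathrm{inv}}=(x\triangleright y)_{\mathrm{inv}}$ and $((x\triangleright y)\triangleright y)_{\mathrm{inv}}=x_{\mathrm{inv}}$ for all $x,y\in \mathrm{MQ}(L)$. The reduced Alexander module $M_A^{\mathrm{red}}(L)$ is the cokernel of the $\Lambda$-linear map $\varrho_D:\Lambda^{C(D)}\to\Lambda^{A(D)}$, $\varrho_D(c)=(1-t)a(c)+tb_1(c)-b_2(c)$; let $\varsigma_D:\Lambda^{A(D)}\to M_A^{\mathrm{red}}(L)$ be the canonical map. Let $A_\mu=\Lambda\oplus\mathbb Z^{\mu-1}$, where $t$ acts trivially on the copies of $\mathbb Z$,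 which are indexed by $2,\dots,\mu$. Let $\phi_\tau:M_A^{\mathrm{red}}(L)\to A_\mu$ be the $\Lambda$-linear map which sends $\varsigma_D(a)$ to $(1,0,\dots,0)$ if $\kappa(a)=1$, and to $(1,0,\dots,0,1,0,\dots,0)$, with the second $1$ in the copy of $\mathbb Z$ with index $\kappa(a)$, if $\kappa(a)>1$. Let $\phi_L^{\mathrm{red}}:M_A^{\mathrm{red}}(L)\to\Lambda$ be its first coordinate. An element $x$ of $M_A^{\mathrm{red}}(L)$ is a meridian of $K_i$ if $\phi_\tau(x)=\phi_\tau(\varsigma_D(a))$ for some arc $a$ with $\kappa(a)=i$. The longitude of $K_i$ is $$\chi_i(L)=\varsigma_D\Bigl(\sum_{c:\,\kappa(b_1(c))=i}w(c)a(c)-\tfrac12\sum_{c:\,\kappa(b_1(c))=i}w(c)\bigl(b_1(c)+b_2(c)\bigr)\Bigr),$$ where the second sum is divisible by $2$ in $\Lambda^{A(D)}$; let $X_i$ be the submodule generated by $\chi_i(L)$. One has $\chi_i(L)\in\ker\phi_L^{\mathrm{red}}$ and $(1-t)\chi_i(L)=0$. **Theorem.** Let $L$ be an oriented virtual link, and for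 each $i\in\{1,\dots,\mu\}$ let $m_i$ be any meridian of $K_i$ in $M_A^{\mathrm{red}}(L)$. Let $S=(1+t)\ker\phi_L^{\mathrm{red}}$, and let $\pi_S:M_A^{\mathrm{red}}(L)\to M_A^{\mathrm{red}}(L)/S$ be the canonical map. Then $\mathrm{IMQ}(L)$ is isomorphic to the quandle $$Q\bigl(\ker\phi_L^{\mathrm{red}}/S,\ \pi_S(m_1),\dots,\pi_S(m_\mu),\ \pi_S(X_1),\dots,\pi_S(X_\mu)\bigr).$$ -/

import Mathlib

open scoped LaurentPolynomial Quandles Pointwise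
open LaurentPolynomial (T)

/-- The ring `Λ = ℤ[t, t⁻¹]`; the variable `t` is `T 1`. -/
abbrev Lam : Type := ℤ[T;T⁻¹]

/-- The augmentation `Λ → ℤ`, `t ↦ 1`. -/
noncomputable def augmentation : Lam →+* ℤ := LaurentPolynomial.eval₂ (RingHom.id ℤ) 1

theorem augmentation_T (n : ℤ) : augmentation (T n) = 1 := by
  simp [augmentation]

/-! ### Quandles given by generators and relations

Throughout, `x ▷ y` is Mathlib's `y ◃ x`: the translation `β_y` is `Shelf.act y`. -/

/-- Formal quandle words in generators from `A`. -/
inductive QuandleTerm.{u} (A : Type u) : Type u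
  | gen : A → QuandleTerm A
  | act : QuandleTerm A → QuandleTerm A → QuandleTerm A
  | invAct : QuandleTerm A → QuandleTerm A → QuandleTerm A

namespace QuandleTerm

/-- The smallest congruence on words that contains the given relations and for which the quotient
is a quandle. -/
inductive Cong.{u} {A : Type u} (R : QuandleTerm A → QuandleTerm A → Prop) :
    QuandleTerm A → QuandleTerm A → Prop
  | refl (x) : Cong R x x
  | symm {x y} : Cong R x y → Cong R y x
  | trans {x y z} : Cong R x y → Cong R y z → Cong R x z
  | act {x x' y y'} : Cong R x x' → Cong R y y' → Cong R (act x y) (act x' y')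
  | invAct {x x' y y'} : Cong R x x' → Cong R y y' → Cong R (invAct x y) (invAct x' y')
  | self_distrib (x y z) : Cong R (.act x (.act y z)) (.act (.act x y) (.act x z))
  | left_inv (x y) : Cong R (.invAct x (.act x y)) y
  | right_inv (x y) : Cong R (.act x (.invAct x y)) y
  | fix (x) : Cong R (.act x x) x
  | rel {x y} : R x y → Cong R x y

/-- The congruence as a setoid. -/
def setoid.{u} {A : Type u} (R : QuandleTerm A → QuandleTerm A → Prop) :
    Setoid (QuandleTerm A) :=
  ⟨Cong R, Cong.refl, Cong.symm, Cong.trans⟩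

end QuandleTerm

/-- The quandle with generators `A` and defining relations `R`. -/
def PresentedQuandle.{u} {A : Type u} (R : QuandleTerm A → QuandleTerm A → Prop) : Type u :=
  Quotient (QuandleTerm.setoid R)

namespace PresentedQuandle

variable {A : Type*} (R : QuandleTerm A → QuandleTerm A → Prop)

/-- The element of a presented quandle given by a generator. -/
def of (a : A) : PresentedQuandle R := Quotient.mk (QuandleTerm.setoid R) (.gen a)

instance : Quandle (PresentedQuandle R) where
  act := Quotient.map₂ .act fun _ _ h _ _ h' => QuandleTerm.Cong.act h h'
  invAct := Quotient.map₂ .invAct fun _ _ h _ _ h' => QuandleTerm.Cong.invAct h h'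
  self_distrib {x y z} := by
    induction x, y using Quotient.inductionOn₂
    induction z using Quotient.inductionOn
    exact Quotient.sound (QuandleTerm.Cong.self_distrib _ _ _)
  left_inv x y := by
    induction x, y using Quotient.inductionOn₂
    exact Quotient.sound (QuandleTerm.Cong.left_inv _ _)
  right_inv x y := by
    induction x, y using Quotient.inductionOn₂
    exact Quotient.sound (QuandleTerm.Cong.right_inv _ _)
  fix {x} := by
    induction x using Quotient.inductionOn
    exact Quotient.sound (QuandleTerm.Cong.fix _)

end PresentedQuandle

/-- The given relations together with all instances of the medial law
`(w ▷ x) ▷ (y ▷ z) = (w ▷ y) ▷ (x ▷ z)`, written in terms of `◃`. -/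
inductive WithMedial.{u} {A : Type u} (R : QuandleTerm A → QuandleTerm A → Prop) :
    QuandleTerm A → QuandleTerm A → Prop
  | of {x y} : R x y → WithMedial R x y
  | medial (w x y z : QuandleTerm A) :
      WithMedial R (.act (.act z y) (.act x w)) (.act (.act z x) (.act y w))

/-- The medial quandle with generators `A` and defining relations `R`. -/
abbrev PresentedMedialQuandle.{u} {A : Type u} (R : QuandleTerm A → QuandleTerm A → Prop) :
    Type u :=
  PresentedQuandle (WithMedial R)

/-- The defining relations of the involutory quotient of `Q`:
`x_inv ▷ y_inv = (x ▷ y)_inv` and `((x ▷ y) ▷ y)_inv = x_inv`. -/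
inductive InvolutoryRel.{u} (Q : Type u) [Quandle Q] : QuandleTerm Q → QuandleTerm Q → Prop
  | act (x y : Q) : InvolutoryRel Q (.act (.gen y) (.gen x)) (.gen (y ◃ x))
  | inv (x y : Q) : InvolutoryRel Q (.gen (y ◃ (y ◃ x))) (.gen x)

/-- The involutory quotient `Q_inv` of a quandle `Q`. -/
abbrev InvolutoryQuotient.{u} (Q : Type u) [Quandle Q] : Type u :=
  PresentedQuandle (InvolutoryRel Q)

/-! ### The quandles `Q(N, (m_i), (X_i))` -/

section ModuleQuandle

variable {M I : Type*} [AddCommGroup M] [Module Lam M]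

/-- The conditions on `N`, `(m_i)` and `(X_i)` under which `Q(N, (m_i), (X_i))` is defined. -/
structure IsQuandleData (N : Submodule Lam M) (m : I → M) (X : I → Submodule Lam M) : Prop where
  sub_mem : ∀ i j, m i - m j ∈ N
  le : ∀ i, X i ≤ N
  smul_eq_zero : ∀ i, ∀ x ∈ X i, (1 - T 1 : Lam) • x = 0

/-- The set `Q(N, (m_i), (X_i))`, the disjoint union of the quotients `N / X_i`. -/
def ModuleQuandle (N : Submodule Lam M) (m : I → M) (X : I → Submodule Lam M)
    (_h : IsQuandleData N m X) : Type _ :=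
  Σ i : I, N ⧸ (X i).submoduleOf N

namespace ModuleQuandle

variable {N : Submodule Lam M} {m : I → M} {X : I → Submodule Lam M}

/-- The element `n + X_i` of `Q_i = N / X_i`. -/
noncomputable def mk (h : IsQuandleData N m X) (i : I) (n : N) : ModuleQuandle N m X h :=
  ⟨i, Submodule.Quotient.mk n⟩

theorem exists_mk (h : IsQuandleData N m X) (x : ModuleQuandle N m X h) :
    ∃ i n, mk h i n = x := by
  obtain ⟨i, x⟩ := x
  obtain ⟨n, rfl⟩ := Submodule.Quotient.mk_surjective _ x
  exact ⟨i, n, rfl⟩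

/-- The map `N / X_j → N / X_i`, `y + X_j ↦ (1 - t) y + X_i`. -/
noncomputable def oneSubT (h : IsQuandleData N m X) (j i : I) :
    (N ⧸ (X j).submoduleOf N) →ₗ[Lam] (N ⧸ (X i).submoduleOf N) :=
  Submodule.mapQ _ _ (LinearMap.lsmul Lam N (1 - T 1)) fun y hy => by
    have h0 : (1 - T 1 : Lam) • y = 0 := Subtype.ext (h.smul_eq_zero j y hy)
    rw [Submodule.mem_comap, LinearMap.lsmul_apply, h0]
    exact zero_mem _

/-- The element `m_j - m_i` of `N`. -/
def diff (h : IsQuandleData N m X) (j i : I) : N := ⟨m j - m i, h.sub_mem j i⟩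

/-- `x ▷ y = m_j - m_i + t x + (1 - t) y + X_i` for `x ∈ Q_i` and `y ∈ Q_j`; the arguments
are in the order `y`, `x`. -/
noncomputable def act (h : IsQuandleData N m X) (y x : ModuleQuandle N m X h) :
    ModuleQuandle N m X h :=
  ⟨x.1, Submodule.Quotient.mk (diff h y.1 x.1) + (T 1 : Lam) • x.2 + oneSubT h y.1 x.1 y.2⟩

/-- The inverse of `act y`. -/
noncomputable def invAct (h : IsQuandleData N m X) (y x : ModuleQuandle N m X h) :
    ModuleQuandle N m X h :=
  ⟨x.1, (T (-1) : Lam) •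
    (x.2 - Submodule.Quotient.mk (diff h y.1 x.1) - oneSubT h y.1 x.1 y.2)⟩

theorem act_mk (h : IsQuandleData N m X) (j i : I) (y x : N) :
    act h (mk h j y) (mk h i x) =
      mk h i (diff h j i + (T 1 : Lam) • x + (1 - T 1 : Lam) • y) := rfl

theorem invAct_mk (h : IsQuandleData N m X) (j i : I) (y x : N) :
    invAct h (mk h j y) (mk h i x) =
      mk h i ((T (-1) : Lam) • (x - diff h j i - (1 - T 1 : Lam) • y)) := rfl

noncomputable instance (h : IsQuandleData N m X) : Quandle (ModuleQuandle N m X h) where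
  act := act h
  invAct := invAct h
  self_distrib {x y z} := by
    obtain ⟨i, x, rfl⟩ := exists_mk h x
    obtain ⟨j, y, rfl⟩ := exists_mk h y
    obtain ⟨k, z, rfl⟩ := exists_mk h z
    simp only [act_mk]
    congr 1
    apply Subtype.ext
    simp only [diff, Submodule.coe_add, Submodule.coe_smul]
    module
  left_inv x y := by
    obtain ⟨i, x, rfl⟩ := exists_mk h x
    obtain ⟨j, y, rfl⟩ := exists_mk h y
    have ht : (T (-1) : Lam) * T 1 = 1 := by
      rw [← LaurentPolynomial.T_add, neg_add_cancel, LaurentPolynomial.T_zero]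
    simp only [act_mk, invAct_mk]
    congr 1
    rw [sub_sub, add_right_comm, add_sub_cancel_left, smul_smul, ht, one_smul]
  right_inv x y := by
    obtain ⟨i, x, rfl⟩ := exists_mk h x
    obtain ⟨j, y, rfl⟩ := exists_mk h y
    have ht : (T 1 : Lam) * T (-1) = 1 := by
      rw [← LaurentPolynomial.T_add, add_neg_cancel, LaurentPolynomial.T_zero]
    simp only [act_mk, invAct_mk]
    congr 1
    rw [smul_smul, ht, one_smul, sub_sub, add_right_comm, add_sub_cancel]
  fix {x} := by
    obtain ⟨i, x, rfl⟩ := exists_mk h x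
    simp only [act_mk]
    congr 1
    apply Subtype.ext
    simp only [diff, Submodule.coe_add, Submodule.coe_smul]
    module

end ModuleQuandle

/-- The conditions are inherited by the images in a quotient module `M / S`. -/
theorem IsQuandleData.map_mkQ {N : Submodule Lam M} {m : I → M} {X : I → Submodule Lam M}
    (h : IsQuandleData N m X) (S : Submodule Lam M) :
    IsQuandleData (N.map S.mkQ) (fun i => S.mkQ (m i)) (fun i => (X i).map S.mkQ) where
  sub_mem i j := ⟨m i - m j, h.sub_mem i j, by simp⟩
  le i := Submodule.map_mono (h.le i)
  smul_eq_zero i := by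
    rintro _ ⟨x, hx, rfl⟩
    rw [← map_smul, h.smul_eq_zero i x hx, map_zero]

end ModuleQuandle

/-! ### Virtual link diagrams -/

/-- A diagram of an oriented virtual link with components `K_i`, `i : Fin μ`, recorded as a signed
Gauss diagram. (Virtual link diagrams up to detour moves and planar isotopy are the same thing as
Gauss diagrams, so virtual crossings leave no trace.)

Each classical crossing `c` is passed twice: `Sum.inl c` is the passage along the overpassing
strand and `Sum.inr c` the passage along the underpassing strand. The permutation `next` sends
a passage to the one that follows it on the same component in the direction of the
orientation. A component without any passage is a curve without classical crossings. -/
structure LinkDiagram (μ : ℕ) where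
  /-- the classical crossings -/
  Crossing : Type
  [fintypeCrossing : Fintype Crossing]
  /-- the writhe of a crossing -/
  writhe : Crossing → ℤˣ
  /-- the next passage -/
  next : Equiv.Perm (Crossing ⊕ Crossing)
  /-- the index of the component on which a passage lies -/
  comp : Crossing ⊕ Crossing → Fin μ
  /-- the passages on one component form one cyclic sequence -/
  comp_eq_iff : ∀ p q, comp p = comp q ↔ next.SameCycle p q

namespace LinkDiagram

attribute [instance] LinkDiagram.fintypeCrossing

variable {μ : ℕ} (D : LinkDiagram μ)

/-- The pieces into which the passages cut the curves: the piece that leaves a given passage and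
leads to the next one, and the whole curve for a component without passages. -/
abbrev Edge : Type := (D.Crossing ⊕ D.Crossing) ⊕ {i : Fin μ // ∀ p, D.comp p ≠ i}

/-- The edges before and after an overpass belong to the same arc. -/
inductive Joined : D.Edge → D.Edge → Prop
  | overpass (c : D.Crossing) : Joined (.inl (D.next.symm (.inl c))) (.inl (.inl c))

/-- The set `A(D)` of arcs: curves are cut at underpasses only. -/
def Arc : Type := Quot D.Joined

theorem comp_next (p : D.Crossing ⊕ D.Crossing) : D.comp (D.next p) = D.comp p :=
  (D.comp_eq_iff _ _).2 (Equiv.Perm.sameCycle_apply_left.2 (Equiv.Perm.SameCycle.refl _ _))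

theorem comp_next_symm (p : D.Crossing ⊕ D.Crossing) : D.comp (D.next.symm p) = D.comp p := by
  simpa using (D.comp_next (D.next.symm p)).symm

/-- The component of an edge. -/
def edgeComp : D.Edge → Fin μ
  | .inl p => D.comp p
  | .inr i => i.1

/-- The index `κ_D(a)` of the component to which the arc `a` belongs. -/
def kappa : D.Arc → Fin μ :=
  Quot.lift D.edgeComp fun _ _ h => by
    cases h with
    | overpass c => exact D.comp_next_symm _

/-- The overpassing arc `a(c)`. -/
def overArc (c : D.Crossing) : D.Arc := Quot.mk _ (.inl (.inl c))

/-- The underpassing arc that ends at `c`. -/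
def underIn (c : D.Crossing) : D.Arc := Quot.mk _ (.inl (D.next.symm (.inr c)))

/-- The underpassing arc that begins at `c`. -/
def underOut (c : D.Crossing) : D.Arc := Quot.mk _ (.inl (.inr c))

/-- The underpassing arc `b₁(c)` on the right of the overpassing arc: the incoming one at
a crossing of writhe `1`, the outgoing one at a crossing of writhe `-1`. -/
def b₁ (c : D.Crossing) : D.Arc := if D.writhe c = 1 then D.underIn c else D.underOut c

/-- The underpassing arc `b₂(c)` on the left of the overpassing arc. -/
def b₂ (c : D.Crossing) : D.Arc := if D.writhe c = 1 then D.underOut c else D.underIn c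

theorem kappa_b₁ (c : D.Crossing) : D.kappa (D.b₁ c) = D.comp (.inr c) := by
  unfold b₁
  split_ifs
  · exact D.comp_next_symm _
  · rfl

theorem kappa_b₂ (c : D.Crossing) : D.kappa (D.b₂ c) = D.comp (.inr c) := by
  unfold b₂
  split_ifs
  · rfl
  · exact D.comp_next_symm _

/-! ### The medial quandle and the involutory medial quandle -/

/-- The crossing relations `q_{b₂(c)} = q_{b₁(c)} ▷ q_{a(c)}`. -/
inductive CrossingRel : QuandleTerm D.Arc → QuandleTerm D.Arc → Prop
  | crossing (c : D.Crossing) :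
      CrossingRel (.gen (D.b₂ c)) (.act (.gen (D.overArc c)) (.gen (D.b₁ c)))

/-- The medial quandle `MQ(L)`. -/
abbrev MQ : Type := PresentedMedialQuandle D.CrossingRel

/-- The involutory medial quandle `IMQ(L)`, the involutory quotient of `MQ(L)`. -/
abbrev IMQ : Type := InvolutoryQuotient D.MQ

/-! ### The reduced Alexander module -/

/-- The map `ϱ_D : Λ^{C(D)} → Λ^{A(D)}`, `c ↦ (1 - t) a(c) + t b₁(c) - b₂(c)`. -/
noncomputable def rho : (D.Crossing →₀ Lam) →ₗ[Lam] (D.Arc →₀ Lam) :=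
  Finsupp.linearCombination Lam fun c =>
    Finsupp.single (D.overArc c) (1 - T 1) + Finsupp.single (D.b₁ c) (T 1)
      - Finsupp.single (D.b₂ c) 1

/-- The reduced Alexander module `M_A^red(L)`, the cokernel of `ϱ_D`. -/
abbrev AlexanderModule : Type := (D.Arc →₀ Lam) ⧸ LinearMap.range D.rho

/-- The canonical map `ς_D`. -/
noncomputable abbrev sigma : (D.Arc →₀ Lam) →ₗ[Lam] D.AlexanderModule :=
  (LinearMap.range D.rho).mkQ

/-- The generator `ς_D(a)` of the reduced Alexander module given by an arc `a`. -/
noncomputable abbrev gen (a : D.Arc) : D.AlexanderModule := D.sigma (Finsupp.single a 1)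

theorem gen_crossing (c : D.Crossing) :
    (1 - T 1 : Lam) • D.gen (D.overArc c) + (T 1 : Lam) • D.gen (D.b₁ c) = D.gen (D.b₂ c) := by
  have h : D.sigma (D.rho (Finsupp.single c 1)) = 0 :=
    (Submodule.Quotient.mk_eq_zero _).2 ⟨_, rfl⟩
  simp only [rho, Finsupp.linearCombination_single, one_smul] at h
  rw [map_sub, map_add, sub_eq_zero] at h
  refine Eq.trans ?_ h
  rw [gen, gen, ← map_smul, ← map_smul, Finsupp.smul_single, Finsupp.smul_single, smul_eq_mul,
    smul_eq_mul, mul_one, mul_one]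

/-! ### Longitudes -/

/-- The classical crossings `c` at which `K_i` is the underpassing component,
`κ_D(b₁(c)) = i`. -/
def underCrossings (i : Fin μ) : Finset D.Crossing := {c | D.kappa (D.b₁ c) = i}

theorem sum_underIn {G : Type*} [AddCommGroup G] (f : D.Arc → G) (i : Fin μ) :
    ∑ c ∈ D.underCrossings i, f (D.underIn c) = ∑ c ∈ D.underCrossings i, f (D.underOut c) := by
  have key : ∑ p with D.comp p = i, f (Quot.mk _ (.inl (D.next.symm p)))
      = ∑ p with D.comp p = i, f (Quot.mk _ (.inl p)) :=
    Finset.sum_equiv D.next.symm (by simp [comp_next_symm]) fun _ _ => rfl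
  simp only [Finset.sum_filter, Fintype.sum_sum_type] at key
  have h (c : D.Crossing) : (Quot.mk D.Joined (.inl (D.next.symm (.inl c))) : D.Arc)
      = Quot.mk _ (.inl (.inl c)) := Quot.sound (.overpass c)
  simp only [h] at key
  simp only [underCrossings, kappa_b₁, Finset.sum_filter]
  exact add_left_cancel key

theorem sum_writhe {G : Type*} [AddCommGroup G] (f : D.Arc → G) (i : Fin μ) :
    ∑ c ∈ D.underCrossings i, (D.writhe c : ℤ) • f (D.b₁ c)
      = ∑ c ∈ D.underCrossings i, (D.writhe c : ℤ) • f (D.b₂ c) := by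
  rw [← sub_eq_zero, ← Finset.sum_sub_distrib, ← sub_eq_zero.2 (D.sum_underIn f i),
    ← Finset.sum_sub_distrib]
  refine Finset.sum_congr rfl fun c _ => ?_
  rcases Int.units_eq_one_or (D.writhe c) with h | h
  · simp [b₁, b₂, h]
  · have : (-1 : ℤˣ) ≠ 1 := by decide
    simp [b₁, b₂, h, this, neg_add_eq_sub]

/-- The half sum `½ ∑ w(c) (b₁(c) + b₂(c))` over the crossings at which `K_i` is the underpassing
component. It has integral coefficients because `∑ w(c) b₁(c) = ∑ w(c) b₂(c)`; see
`two_nsmul_eq_iff`. -/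
noncomputable def halfSum (i : Fin μ) : D.Arc →₀ Lam :=
  ∑ c ∈ D.underCrossings i, (D.writhe c : ℤ) • Finsupp.single (D.b₁ c) 1

/-- `halfSum` is the unique solution `z` of `2 z = ∑ w(c) (b₁(c) + b₂(c))`. -/
theorem two_nsmul_eq_iff (i : Fin μ) (z : D.Arc →₀ Lam) :
    2 • z = ∑ c ∈ D.underCrossings i, (D.writhe c : ℤ) •
      (Finsupp.single (D.b₁ c) 1 + Finsupp.single (D.b₂ c) 1) ↔ z = D.halfSum i := by
  have h : ∑ c ∈ D.underCrossings i, (D.writhe c : ℤ) •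
      (Finsupp.single (D.b₁ c) 1 + Finsupp.single (D.b₂ c) 1) = 2 • D.halfSum i := by
    simp only [smul_add, Finset.sum_add_distrib]
    rw [← D.sum_writhe (fun a => Finsupp.single a (1 : Lam)), two_nsmul, halfSum]
  rw [h]
  refine ⟨fun h2 => ?_, fun h2 => by rw [h2]⟩
  ext a : 1
  have h3 := DFunLike.congr_fun h2 a
  simp only [Finsupp.smul_apply, nsmul_eq_mul] at h3
  refine mul_left_cancel₀ (fun h4 => ?_) h3
  have h5 := congrArg augmentation h4
  rw [map_natCast, map_zero] at h5
  exact absurd h5 (by decide)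

/-- The longitude `χ_i(L)`. -/
noncomputable def longitude (i : Fin μ) : D.AlexanderModule :=
  D.sigma (∑ c ∈ D.underCrossings i, (D.writhe c : ℤ) • Finsupp.single (D.overArc c) 1
    - D.halfSum i)

/-- The cyclic submodule `X_i` generated by the longitude `χ_i(L)`. -/
noncomputable def longitudeModule (i : Fin μ) : Submodule Lam D.AlexanderModule :=
  Submodule.span Lam {D.longitude i}

theorem longitude_eq (i : Fin μ) : D.longitude i =
    ∑ c ∈ D.underCrossings i, (D.writhe c : ℤ) • (D.gen (D.overArc c) - D.gen (D.b₁ c)) := by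
  simp only [longitude, halfSum, map_sub, map_sum, map_zsmul, smul_sub, Finset.sum_sub_distrib]

theorem smul_longitude (i : Fin μ) : (1 - T 1 : Lam) • D.longitude i = 0 := by
  have h (c : D.Crossing) : (1 - T 1 : Lam) • (D.gen (D.overArc c) - D.gen (D.b₁ c))
      = D.gen (D.b₂ c) - D.gen (D.b₁ c) := by
    rw [← gen_crossing]
    module
  simp only [longitude_eq, Finset.smul_sum, smul_comm (1 - T 1 : Lam), h]
  simp only [smul_sub, Finset.sum_sub_distrib]
  rw [D.sum_writhe D.gen, sub_self]

end LinkDiagram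

/-- The group `ℤ ^ ι`, with the `Λ`-module structure in which `t` acts trivially. -/
def TrivialModule (ι : Type) : Type := ι → ℤ

instance (ι : Type) : AddCommGroup (TrivialModule ι) := inferInstanceAs (AddCommGroup (ι → ℤ))

noncomputable instance (ι : Type) : Module Lam (TrivialModule ι) :=
  Module.compHom (ι → ℤ) augmentation

/-- The module `A_μ = Λ ⊕ ℤ ^ (μ - 1)`; the copies of `ℤ` are indexed by the components other than
the first one. -/
abbrev AMu (μ : ℕ) [NeZero μ] : Type := Lam × TrivialModule {i : Fin μ // i ≠ 0}

namespace LinkDiagram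

variable {μ : ℕ} [NeZero μ] (D : LinkDiagram μ)

/-- The element `(1, 0, …, 0, 1, 0, …, 0)` of `A_μ` that belongs to the `i`-th component; it is
`(1, 0, …, 0)` for the first component. -/
noncomputable def unitVec (i : Fin μ) : AMu μ := (1, fun j => if j.1 = i then 1 else 0)

/-- The map `F : Λ^{A(D)} → A_μ`. -/
noncomputable def F : (D.Arc →₀ Lam) →ₗ[Lam] AMu μ :=
  Finsupp.linearCombination Lam fun a => unitVec (D.kappa a)

theorem oneSubT_smul_unitVec (i j : Fin μ) :
    (1 - T 1 : Lam) • unitVec i = (1 - T 1 : Lam) • unitVec j := by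
  refine Prod.ext rfl (funext fun k => ?_)
  change augmentation (1 - T 1) * _ = augmentation (1 - T 1) * _
  simp [augmentation_T]

theorem F_rho : D.F ∘ₗ D.rho = 0 := by
  refine Finsupp.lhom_ext' fun c => LinearMap.ext_ring ?_
  simp only [F, rho, kappa_b₁, kappa_b₂, LinearMap.comp_apply, LinearMap.zero_apply,
    Finsupp.lsingle_apply, Finsupp.linearCombination_single, one_smul, map_sub, map_add]
  rw [oneSubT_smul_unitVec _ (D.comp (.inr c))]
  module

/-- The map `φ_τ : M_A^red(L) → A_μ` induced by `F`. -/
noncomputable def phiTau : D.AlexanderModule →ₗ[Lam] AMu μ :=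
  (LinearMap.range D.rho).liftQ D.F (LinearMap.range_le_ker_iff.2 D.F_rho)

/-- The map `φ_L^red : M_A^red(L) → Λ`, the first coordinate of `φ_τ`. -/
noncomputable def phiRed : D.AlexanderModule →ₗ[Lam] Lam := LinearMap.fst _ _ _ ∘ₗ D.phiTau

/-- The reduced Alexander invariant `ker φ_L^red`. -/
noncomputable abbrev kerPhiRed : Submodule Lam D.AlexanderModule := LinearMap.ker D.phiRed

theorem phiTau_gen (a : D.Arc) : D.phiTau (D.gen a) = unitVec (D.kappa a) := by
  simp [phiTau, F]

theorem phiRed_gen (a : D.Arc) : D.phiRed (D.gen a) = 1 := by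
  rw [phiRed, LinearMap.comp_apply, phiTau_gen]
  rfl

/-! ### Meridians -/

/-- The set `M_i(L)` of meridians of `K_i` in the reduced Alexander module. -/
def meridians (i : Fin μ) : Set D.AlexanderModule :=
  {x | ∃ a : D.Arc, D.kappa a = i ∧ D.phiTau x = D.phiTau (D.gen a)}

theorem longitude_mem (i : Fin μ) : D.longitude i ∈ D.kerPhiRed := by
  rw [longitude_eq, LinearMap.mem_ker, map_sum]
  refine Finset.sum_eq_zero fun c _ => ?_
  rw [map_zsmul, map_sub, phiRed_gen, phiRed_gen, sub_self, smul_zero]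

/-- For any choice of meridians, `ker φ_L^red`, `(m_i)` and `(X_i)` define a quandle. -/
theorem isQuandleData {m : Fin μ → D.AlexanderModule} (hm : ∀ i, m i ∈ D.meridians i) :
    IsQuandleData D.kerPhiRed m D.longitudeModule where
  sub_mem i j := by
    have h (k : Fin μ) : D.phiRed (m k) = 1 := by
      obtain ⟨a, -, ha⟩ := hm k
      rw [← D.phiRed_gen a, phiRed, LinearMap.comp_apply, ha, LinearMap.comp_apply]
    rw [LinearMap.mem_ker, map_sub, h, h, sub_self]
  le i := by
    rw [longitudeModule, Submodule.span_singleton_le_iff_mem]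
    exact D.longitude_mem i
  smul_eq_zero i x hx := by
    obtain ⟨r, rfl⟩ := Submodule.mem_span_singleton.1 hx
    rw [smul_comm, smul_longitude, smul_zero]

/-- The submodule `S = (1 + t) ker φ_L^red`. -/
noncomputable def S : Submodule Lam D.AlexanderModule := (1 + T 1 : Lam) • D.kerPhiRed

end LinkDiagram

/-! Write β_x for the translation by x. In an involutory medial quandle the products β_x β_y
generate an abelian group, which every translation inverts under conjugation. Let t act on it by -1.
At t = -1 the crossing relation reads b₂ = 2a - b₁, and this is the rule β_{b₁ ▷ a} = β_a β_{b₁}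
β_a. Hence the Alexander module maps linearly to the displacement group of `IMQ(L)`, a difference of
arcs a - b going to β_a β_b (`exists_toDis`). The map kills S, so ker φ / S acts on `IMQ(L)`.

Along a component, each underpass moves the generator of the arc before it to that of the arc after
it, by ±(a(c) - b₁(c)). So the generators of one component lie in one orbit, and a full turn shows
that the longitude fixes them (`exists_move_eq`, `move_longitude`). Every element is a displaced
generator (`exists_eq_move`), so `IMQ(L)` is no larger than the disjoint union of the quotients of
ker φ / S by the images of the X_i.

For a map onto this union, q_a is sent to a pair (κ(a), n) with (1 - t) n = a - m_κ(a). Such n exist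
because ker φ_τ lies in (1 - t) ker φ. They must also grow by the passage terms along each
component, which is consistent modulo the longitude (`exists_potential`, `exists_isArcImage`). The
resulting homomorphism intertwines the action of ker φ with addition (`map_move_eq_shift`). It is
onto because addition is transitive on each summand, and injective because S and the longitudes
already act trivially where required. -/

/-! ### Maps out of presented quandles -/

/-- A map of quandles preserves the inverse translations. -/
theorem ShelfHom.map_invAct {P Q : Type*} [Quandle P] [Quandle Q] (f : P →◃ Q) (x y : P) :
    f (x ◃⁻¹ y) = f x ◃⁻¹ f y := by
  rw [← Rack.left_cancel (f x), ← ShelfHom.map_act, Rack.act_invAct_eq, Rack.act_invAct_eq]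

namespace QuandleTerm

/-- The value of a word in a quandle. -/
def eval {A Q : Type*} [Quandle Q] (φ : A → Q) : QuandleTerm A → Q
  | gen a => φ a
  | act x y => eval φ x ◃ eval φ y
  | invAct x y => eval φ x ◃⁻¹ eval φ y

theorem Cong.eval_eq {A Q : Type*} [Quandle Q] {φ : A → Q}
    {R : QuandleTerm A → QuandleTerm A → Prop} (h : ∀ x y, R x y → eval φ x = eval φ y)
    {x y : QuandleTerm A} (hxy : Cong R x y) : eval φ x = eval φ y := by
  induction hxy with
  | refl => rfl
  | symm _ ih => exact ih.symm
  | trans _ _ ih ih' => exact ih.trans ih'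
  | act _ _ ih ih' => simp only [eval, ih, ih']
  | invAct _ _ ih ih' => simp only [eval, ih, ih']
  | self_distrib => exact Shelf.self_distrib
  | left_inv => exact Rack.invAct_act_eq _ _
  | right_inv => exact Rack.act_invAct_eq _ _
  | fix => exact Quandle.fix
  | rel hr => exact h _ _ hr

end QuandleTerm

namespace PresentedQuandle

section

variable {A Q : Type*} [Quandle Q] {R : QuandleTerm A → QuandleTerm A → Prop}

/-- The universal property of a presented quandle. -/
def lift (φ : A → Q) (h : ∀ x y, R x y → QuandleTerm.eval φ x = QuandleTerm.eval φ y) :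
    PresentedQuandle R →◃ Q where
  toFun := Quotient.lift (QuandleTerm.eval φ) fun _ _ hxy => QuandleTerm.Cong.eval_eq h hxy
  map_act' {x y} := by
    induction x, y using Quotient.inductionOn₂
    rfl

theorem mk_eq_eval (x : QuandleTerm A) :
    (Quotient.mk (QuandleTerm.setoid R) x : PresentedQuandle R) = x.eval (of R) := by
  induction x with
  | gen => rfl
  | act x y hx hy => exact congrArg₂ (fun x y : PresentedQuandle R => x ◃ y) hx hy
  | invAct x y hx hy => exact congrArg₂ (fun x y : PresentedQuandle R => x ◃⁻¹ y) hx hy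

theorem eval_of_eq {x y : QuandleTerm A} (h : R x y) : x.eval (of R) = y.eval (of R) := by
  rw [← mk_eq_eval, ← mk_eq_eval]
  exact Quotient.sound (.rel h)

theorem induction_on {C : PresentedQuandle R → Prop} (x : PresentedQuandle R)
    (of : ∀ a, C (of R a)) (act : ∀ x y, C x → C y → C (x ◃ y))
    (invAct : ∀ x y, C x → C y → C (x ◃⁻¹ y)) : C x := by
  induction x using Quotient.inductionOn with
  | _ x =>
    rw [mk_eq_eval]
    induction x with
    | gen a => exact of a
    | act x y hx hy => exact act _ _ hx hy
    | invAct x y hx hy => exact invAct _ _ hx hy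

end

theorem medial {A : Type*} (R : QuandleTerm A → QuandleTerm A → Prop)
    (w x y z : PresentedMedialQuandle R) : (z ◃ y) ◃ (x ◃ w) = (z ◃ x) ◃ (y ◃ w) := by
  induction w, x using Quotient.inductionOn₂
  induction y, z using Quotient.inductionOn₂
  exact Quotient.sound (.rel (.medial _ _ _ _))

end PresentedQuandle

namespace InvolutoryQuotient

variable (Q : Type*) [Quandle Q]

/-- The canonical map `x ↦ x_inv`. -/
def toInv : Q →◃ InvolutoryQuotient Q where
  toFun := PresentedQuandle.of _
  map_act' {x y} := (PresentedQuandle.eval_of_eq (InvolutoryRel.act y x)).symm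

theorem toInv_surjective : Function.Surjective (toInv Q) := by
  intro x
  induction x using PresentedQuandle.induction_on with
  | of a => exact ⟨a, rfl⟩
  | act _ _ hx hy =>
    obtain ⟨⟨x, rfl⟩, ⟨y, rfl⟩⟩ := And.intro hx hy
    exact ⟨x ◃ y, ShelfHom.map_act _⟩
  | invAct _ _ hx hy =>
    obtain ⟨⟨x, rfl⟩, ⟨y, rfl⟩⟩ := And.intro hx hy
    exact ⟨x ◃⁻¹ y, ShelfHom.map_invAct _ _ _⟩

theorem isInvolutory : Rack.IsInvolutory (InvolutoryQuotient Q) := by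
  intro x y
  obtain ⟨x, rfl⟩ := toInv_surjective Q x
  obtain ⟨y, rfl⟩ := toInv_surjective Q y
  rw [← ShelfHom.map_act, ← ShelfHom.map_act]
  exact PresentedQuandle.eval_of_eq (InvolutoryRel.inv y x)

end InvolutoryQuotient

/-! ### The displacement group of an involutory medial quandle -/

/-- Involutory medial quandles. -/
class IsInvolutoryMedial (P : Type*) [Quandle P] : Prop where
  involutory : Rack.IsInvolutory P
  medial (w x y z : P) : (z ◃ y) ◃ (x ◃ w) = (z ◃ x) ◃ (y ◃ w)

namespace IsInvolutoryMedial

open Rack (act')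

variable {P : Type*} [Quandle P]

variable (P) in
/-- The group generated by the products of two translations. -/
def Dis : Subgroup (Equiv.Perm P) :=
  Subgroup.closure (Set.range fun a : P × P => act' a.1 * act' a.2)

/-- The displacement that is the product of two translations. -/
def dis (x y : P) : Dis P := ⟨act' x * act' y, Subgroup.subset_closure ⟨(x, y), rfl⟩⟩

/-- The displacement group, written additively. -/
abbrev AddDis (P : Type*) [Quandle P] : Type _ := Additive (Dis P)

/-- The action of a displacement. -/
def move (d : AddDis P) (x : P) : P := (Additive.toMul d).1 x

theorem move_zero (x : P) : move 0 x = x := rfl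

theorem move_add (d e : AddDis P) (x : P) : move (d + e) x = move d (move e x) := rfl

theorem move_neg_move (d : AddDis P) (x : P) : move (-d) (move d x) = x := by
  rw [← move_add, neg_add_cancel, move_zero]

theorem move_dis (x y z : P) : move (Additive.ofMul (dis x y)) z = x ◃ (y ◃ z) := rfl

variable [IsInvolutoryMedial P]

theorem act_act (x y : P) : x ◃ (x ◃ y) = y := involutory x y

theorem act'_mul_self (x : P) : act' x * act' x = 1 := Equiv.ext fun y => act_act x y

theorem inv_act' (x : P) : (act' x)⁻¹ = act' x := inv_eq_of_mul_eq_one_left (act'_mul_self x)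

theorem act'_act (x y : P) : act' (x ◃ y) = act' x * act' y * act' x := by
  rw [Rack.ad_conj, inv_act']

/-- The medial law gives β_y β_x β_y β_z = β_y β_z β_y β_x; cancel the first factor. This reversal
of triples is the source of commutativity and of the inversion of displacements. -/
theorem act'_mul_act'_mul_act' (x y z : P) :
    act' x * act' y * act' z = act' z * act' y * act' x := by
  have h : act' (y ◃ x) * act' z = act' (y ◃ z) * act' x :=
    Equiv.ext fun w => medial w z x y
  rw [act'_act, act'_act, mul_assoc, mul_assoc, mul_assoc, mul_assoc, mul_left_cancel_iff] at h
  have h2 : act' x * (act' y * act' z) = act' z * (act' y * act' x) := h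
  simpa only [mul_assoc] using h2

theorem dis_mul_comm (d e : Dis P) : d * e = e * d := by
  have : IsMulCommutative (Dis P) := Subgroup.isMulCommutative_closure <| by
    rintro _ ⟨⟨x, y⟩, rfl⟩ _ ⟨⟨z, w⟩, rfl⟩
    change act' x * act' y * (act' z * act' w) = act' z * act' w * (act' x * act' y)
    -- Two reversals: x(yzw) = (xwz)y = zwxy.
    rw [← mul_assoc, mul_assoc (act' x), mul_assoc (act' x), act'_mul_act'_mul_act' y z w,
      ← mul_assoc, ← mul_assoc, act'_mul_act'_mul_act' x w z, mul_assoc _ (act' x)]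
  exact this.is_comm.comm d e

instance : CommGroup (Dis P) where
  mul_comm := dis_mul_comm

/-- The variable `t` acts on the displacement group as `-1`. -/
noncomputable instance : Module Lam (AddDis P) :=
  Module.compHom _ (LaurentPolynomial.eval₂ (RingHom.id ℤ) (-1 : ℤˣ))

theorem T_one_smul (d : AddDis P) : (T 1 : Lam) • d = -d := by
  change LaurentPolynomial.eval₂ (RingHom.id ℤ) (-1 : ℤˣ) (T 1) • d = -d
  simp

theorem neg_dis (x y : P) : -Additive.ofMul (dis x y) = Additive.ofMul (dis y x) := by
  refine Additive.toMul.injective (Subtype.ext ?_)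
  change (act' x * act' y)⁻¹ = act' y * act' x
  rw [mul_inv_rev, inv_act', inv_act']

theorem dis_sub_dis (x y z : P) :
    Additive.ofMul (dis x z) - Additive.ofMul (dis y z) = Additive.ofMul (dis x y) := by
  rw [sub_eq_add_neg, neg_dis]
  refine Additive.toMul.injective (Subtype.ext ?_)
  change act' x * act' z * (act' z * act' y) = act' x * act' y
  rw [mul_assoc, ← mul_assoc (act' z), act'_mul_self, one_mul]

/-- Since β_{x ◃ y} = β_x β_y β_x, the left side is the product of β_x β_y and β_x β_z. This is the
Alexander relation at t = -1. -/
theorem dis_act (x y z : P) : Additive.ofMul (dis (x ◃ y) z)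
    = (2 : ℤ) • Additive.ofMul (dis x z) - Additive.ofMul (dis y z) := by
  rw [two_zsmul, add_sub_assoc, dis_sub_dis, add_comm (Additive.ofMul (dis x z))]
  refine Additive.toMul.injective (Subtype.ext ?_)
  change act' (x ◃ y) * act' z = act' x * act' y * (act' x * act' z)
  simp only [act'_act, mul_assoc]

/-- A translation inverts the displacements. -/
theorem act_move (x : P) (d : AddDis P) (y : P) : x ◃ move d y = move (-d) (x ◃ y) := by
  have h (d : Equiv.Perm P) (hd : d ∈ Dis P) : act' x * d = d⁻¹ * act' x := by
    induction hd using Subgroup.closure_induction with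
    | mem d hd =>
      obtain ⟨⟨y, z⟩, rfl⟩ := hd
      rw [mul_inv_rev, inv_act', inv_act', ← mul_assoc, act'_mul_act'_mul_act']
    | one => simp
    | mul d e hd he ihd ihe =>
      have hc : e * d = d * e := congrArg Subtype.val (dis_mul_comm (⟨e, he⟩ : Dis P) ⟨d, hd⟩)
      rw [← hc, ← mul_assoc, ihe, mul_assoc, ihd, ← mul_assoc, ← mul_inv_rev, hc]
    | inv d hd ihd =>
      rw [inv_inv, ← mul_right_inj d⁻¹, ← mul_assoc, ← ihd, mul_assoc, mul_inv_cancel, mul_one,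
        inv_mul_cancel_left]
  exact DFunLike.congr_fun (h d.toMul.1 d.toMul.2) y

/-- The translation by a displaced element. -/
theorem move_act (d : AddDis P) (x y : P) : move d x ◃ y = move ((2 : ℤ) • d) (x ◃ y) := by
  have h (d : Equiv.Perm P) (hd : d ∈ Dis P) : act' (d x) = d * act' x * d⁻¹ := by
    induction hd using Subgroup.closure_induction generalizing x with
    | mem d hd =>
      obtain ⟨⟨y, z⟩, rfl⟩ := hd
      change act' (y ◃ (z ◃ x)) = _
      rw [Rack.ad_conj, Rack.ad_conj, mul_inv_rev]
      simp only [mul_assoc]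
    | one => simp
    | mul d e _ _ ihd ihe =>
      rw [Equiv.Perm.mul_apply, ihd, ihe, mul_inv_rev]
      simp only [mul_assoc]
    | inv d _ ihd =>
      have h2 := ihd (d⁻¹ x)
      rw [show d (d⁻¹ x) = x from d.apply_symm_apply x] at h2
      rw [h2, inv_inv]
      group
  -- β_{d x} = d β_x d⁻¹, and β_x inverts d, so the result is d² β_x.
  have h2 : move d x ◃ y = move d (x ◃ move (-d) y) :=
    DFunLike.congr_fun (h d.toMul.1 d.toMul.2) y
  rw [h2, act_move, neg_neg, ← move_add, two_zsmul]

end IsInvolutoryMedial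

/-! ### Generators of `IMQ(L)` and the map to its displacement group -/

namespace LinkDiagram

open IsInvolutoryMedial (AddDis move dis)

variable {μ : ℕ} (D : LinkDiagram μ)

instance : IsInvolutoryMedial D.IMQ where
  involutory := InvolutoryQuotient.isInvolutory _
  medial w x y z := by
    obtain ⟨w, rfl⟩ := InvolutoryQuotient.toInv_surjective _ w
    obtain ⟨x, rfl⟩ := InvolutoryQuotient.toInv_surjective _ x
    obtain ⟨y, rfl⟩ := InvolutoryQuotient.toInv_surjective _ y
    obtain ⟨z, rfl⟩ := InvolutoryQuotient.toInv_surjective _ z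
    simp only [← ShelfHom.map_act, PresentedQuandle.medial _ w x y z]

/-- The generator of `IMQ(L)` that belongs to an arc. -/
def invGen (a : D.Arc) : D.IMQ := InvolutoryQuotient.toInv _ (PresentedQuandle.of _ a)

theorem invGen_b₂ (c : D.Crossing) :
    D.invGen (D.b₂ c) = D.invGen (D.overArc c) ◃ D.invGen (D.b₁ c) := by
  rw [invGen, invGen, invGen, ← ShelfHom.map_act]
  exact congrArg _ (PresentedQuandle.eval_of_eq (WithMedial.of (CrossingRel.crossing c)))

theorem imq_induction_on {C : D.IMQ → Prop} (x : D.IMQ) (gen : ∀ a, C (D.invGen a))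
    (act : ∀ x y, C x → C y → C (x ◃ y)) : C x := by
  obtain ⟨x, rfl⟩ := InvolutoryQuotient.toInv_surjective _ x
  induction x using PresentedQuandle.induction_on with
  | of a => exact gen a
  | act x y hx hy => exact ShelfHom.map_act (InvolutoryQuotient.toInv D.MQ) ▸ act _ _ hx hy
  | invAct x y hx hy =>
    rw [ShelfHom.map_invAct, Rack.involutory_invAct_eq_act IsInvolutoryMedial.involutory]
    exact act _ _ hx hy

/-- The universal property of `IMQ(L)`. -/
theorem exists_imq_hom {Q : Type*} [Quandle Q] [IsInvolutoryMedial Q] (φ : D.Arc → Q)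
    (h : ∀ c, φ (D.b₂ c) = φ (D.overArc c) ◃ φ (D.b₁ c)) :
    ∃ f : D.IMQ →◃ Q, ∀ a, f (D.invGen a) = φ a := by
  let g : D.MQ →◃ Q := PresentedQuandle.lift φ <| by
    rintro _ _ (⟨⟨c⟩⟩ | ⟨w, x, y, z⟩)
    · exact h c
    · exact IsInvolutoryMedial.medial _ _ _ _
  refine ⟨PresentedQuandle.lift g ?_, fun a => rfl⟩
  rintro _ _ (⟨x, y⟩ | ⟨x, y⟩)
  · exact (ShelfHom.map_act g).symm
  · simp only [QuandleTerm.eval, ShelfHom.map_act, IsInvolutoryMedial.act_act]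

/-- The linear map into the displacement group which sends a difference of arcs to the product of
the two translations. -/
theorem exists_toDis (a₀ : D.Arc) : ∃ g : D.AlexanderModule →ₗ[Lam] AddDis D.IMQ,
    ∀ a b, g (D.gen a - D.gen b) = Additive.ofMul (dis (D.invGen a) (D.invGen b)) := by
  -- The base arc only makes single arcs into displacements; it cancels in differences.
  let g₀ : (D.Arc →₀ Lam) →ₗ[Lam] AddDis D.IMQ :=
    Finsupp.linearCombination Lam fun a => Additive.ofMul (dis (D.invGen a) (D.invGen a₀))
  have hg : LinearMap.range D.rho ≤ LinearMap.ker g₀ := by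
    rw [LinearMap.range_le_ker_iff]
    refine Finsupp.lhom_ext' fun c => LinearMap.ext_ring ?_
    simp only [rho, LinearMap.comp_apply, LinearMap.zero_apply, Finsupp.lsingle_apply,
      Finsupp.linearCombination_single, one_smul, map_sub, map_add, g₀]
    rw [invGen_b₂, IsInvolutoryMedial.dis_act, sub_smul, IsInvolutoryMedial.T_one_smul,
      IsInvolutoryMedial.T_one_smul, one_smul]
    abel
  refine ⟨(LinearMap.range D.rho).liftQ g₀ hg, fun a b => ?_⟩
  have h (a : D.Arc) : (LinearMap.range D.rho).liftQ g₀ hg (D.gen a)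
      = Additive.ofMul (dis (D.invGen a) (D.invGen a₀)) := by
    change g₀ (Finsupp.single a 1) = _
    simp [g₀]
  rw [map_sub, h, h, IsInvolutoryMedial.dis_sub_dis]

end LinkDiagram

/-! ### Potentials on the cycles of a permutation -/

section Potential

open Finset

variable {α G : Type*} [AddCommGroup G] {σ : Equiv.Perm α}

theorem Equiv.Perm.isCycleOn_fiber [Fintype α] {ι : Type*} [DecidableEq ι] {comp : α → ι}
    (hcomp : ∀ p q, comp p = comp q ↔ σ.SameCycle p q) (i : ι) :
    σ.IsCycleOn ({p | comp p = i} : Finset α) := by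
  have hσ (p : α) : comp (σ p) = comp p :=
    (hcomp _ _).2 (Equiv.Perm.sameCycle_apply_left.2 (.refl _ _))
  refine ⟨⟨fun p hp => ?_, σ.injective.injOn, fun p hp => ⟨σ.symm p, ?_, by simp⟩⟩,
    fun p hp q hq => (hcomp p q).1 ?_⟩
  · simpa [hσ] using hp
  · simpa [← hσ (σ.symm p)] using hp
  · simp only [coe_filter, mem_univ, true_and, Set.mem_ofPred_eq] at hp hq
    rw [hp, hq]

/-- A walk of `#s` steps from a arrives once at each point, and at a last. The exponent j + 1 is
used because δ is charged on arrival. -/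
theorem Equiv.Perm.IsCycleOn.sum_range_pow_succ {s : Finset α} (hs : σ.IsCycleOn s) {a : α}
    (ha : a ∈ s) (δ : α → G) : ∑ j ∈ range #s, δ ((σ ^ (j + 1)) a) = ∑ p ∈ s, δ p := by
  refine sum_nbij (fun j => (σ ^ (j + 1)) a) (fun j _ => hs.1.mapsTo.perm_pow _ ha) ?_ ?_
    fun _ _ => rfl
  · intro j hj k hk h
    have h2 := ((hs.pow_apply_eq_pow_apply ha).1 h).add_right_cancel'
    exact h2.eq_of_lt_of_lt (by simpa using hj) (by simpa using hk)
  · intro b hb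
    obtain ⟨c, hc, rfl⟩ := hs.1.surjOn hb
    obtain ⟨n, hn, rfl⟩ := hs.exists_pow_eq ha hc
    exact ⟨n, by simpa using hn, by simp only [pow_succ', Equiv.Perm.mul_apply]⟩

/-- If the sum of `δ` over each cycle of `σ` lies in the subgroup `X` of that cycle, then modulo
these subgroups `δ` is the coboundary of a function `ν`. If the pairs `(p, ν p)` can be chosen to
satisfy a condition at one point of each cycle, then they satisfy it everywhere. -/
theorem exists_potential [Fintype α] {ι : Type*} [DecidableEq ι] {comp : α → ι}
    (hcomp : ∀ p q, comp p = comp q ↔ σ.SameCycle p q) (X : ι → AddSubgroup G) (δ : α → G)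
    (hδ : ∀ i, ∑ p with comp p = i, δ p ∈ X i) (R : α → G → Prop) (hR : ∀ p, ∃ x, R p x)
    (hstep : ∀ p x, R p x → R (σ p) (x + δ (σ p))) :
    ∃ ν : α → G, (∀ p, R p (ν p)) ∧ ∀ p, ν (σ p) - (ν p + δ (σ p)) ∈ X (comp p) := by
  have hcyc := Equiv.Perm.isCycleOn_fiber hcomp
  let S (r : α) (n : ℕ) : G := ∑ j ∈ range n, δ ((σ ^ (j + 1)) r)
  have hRS (r : α) (x : G) (hx : R r x) (n : ℕ) : R ((σ ^ n) r) (x + S r n) := by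
    induction n with
    | zero => simpa [S] using hx
    | succ n ih =>
      have h := hstep _ _ ih
      rw [← Equiv.Perm.mul_apply, ← pow_succ'] at h
      simpa only [S, sum_range_succ, add_assoc] using h
  -- Each extra full turn adds the sum over the cycle, which lies in X. So modulo X the partial sums
  -- depend only on the endpoint of the walk.
  have hper (r : α) (k n : ℕ) : S r (n + k * #{p | comp p = comp r}) - S r n ∈ X (comp r) := by
    have hr : r ∈ ({p | comp p = comp r} : Finset α) := by simp
    induction k with
    | zero => simp
    | succ k ih =>
      have h : S r (n + (k + 1) * #{p | comp p = comp r}) = S r (n + k * #{p | comp p = comp r})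
          + ∑ p with comp p = comp r, δ p := by
        have hm : (σ ^ (n + k * #{p | comp p = comp r})) r
            ∈ ({p | comp p = comp r} : Finset α) := (hcyc _).1.mapsTo.perm_pow _ hr
        rw [← (hcyc _).sum_range_pow_succ hm, add_mul, one_mul, ← add_assoc]
        simp only [S, sum_range_add]
        refine congrArg _ (sum_congr rfl fun j _ => ?_)
        rw [← Equiv.Perm.mul_apply, ← pow_add]
        congr 3
        omega
      rw [h, add_sub_right_comm]
      exact add_mem ih (hδ _)
  have hS (r : α) (a b : ℕ) (hab : (σ ^ a) r = (σ ^ b) r) : S r a - S r b ∈ X (comp r) := by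
    have hr : r ∈ ({p | comp p = comp r} : Finset α) := by simp
    have hmod := ((hcyc _).pow_apply_eq_pow_apply hr).1 hab
    have ha := hper r (a / #{p | comp p = comp r}) (a % #{p | comp p = comp r})
    have hb := hper r (b / #{p | comp p = comp r}) (b % #{p | comp p = comp r})
    rw [mul_comm, Nat.mod_add_div] at ha hb
    have hmod' : a % #{p | comp p = comp r} = b % #{p | comp p = comp r} := hmod
    rw [← hmod'] at hb
    simpa using sub_mem ha hb
  -- One starting point per cycle: ν p is the starting value plus the sum along some walk from there
  -- to p.
  let rep (p : α) : α := (Quotient.mk (Equiv.Perm.SameCycle.setoid σ) p).out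
  have hrep (p : α) : σ.SameCycle (rep p) p :=
    Quotient.mk_out (s := Equiv.Perm.SameCycle.setoid σ) p
  have hrepσ (p : α) : rep (σ p) = rep p :=
    congrArg Quotient.out (Quotient.sound (s := Equiv.Perm.SameCycle.setoid σ)
      (Equiv.Perm.sameCycle_apply_left.2 (.refl _ _)))
  have hk (p : α) : ∃ n : ℕ, (σ ^ n) (rep p) = p := by
    obtain ⟨n, -, hn⟩ := (hcyc (comp p)).exists_pow_eq (a := rep p) (b := p)
      (by simpa using (hcomp _ _).2 (hrep p)) (by simp)
    exact ⟨n, hn⟩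
  choose k hk using hk
  choose x hx using hR
  refine ⟨fun p => x (rep p) + S (rep p) (k p), fun p => ?_, fun p => ?_⟩
  · simpa only [hk] using hRS (rep p) _ (hx _) (k p)
  · have h : S (rep p) (k p + 1) = S (rep p) (k p) + δ (σ p) := by
      simp only [S, sum_range_succ]
      rw [pow_succ', Equiv.Perm.mul_apply, hk]
    have h2 := hS (rep p) (k (σ p)) (k p + 1) <| by
      rw [pow_succ', Equiv.Perm.mul_apply, hk, ← hrepσ, hk]
    rw [(hcomp _ _).2 (hrep p), h] at h2
    simp only [hrepσ]
    rwa [add_assoc, add_sub_add_left_eq_sub]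

end Potential

/-! ### Modules on which t acts as a sign -/

namespace LaurentPolynomial

/-- If `t` acts as a sign, then every Laurent polynomial acts as its value at this sign. -/
theorem smul_eq_eval₂_smul {M : Type*} [AddCommGroup M] [Module Lam M] (u : ℤˣ) {x : M}
    (hx : (T 1 : Lam) • x = (u : ℤ) • x) (r : Lam) :
    r • x = eval₂ (RingHom.id ℤ) u r • x := by
  have hC (a : ℤ) (y : M) : (C a : Lam) • y = a • y := by
    rw [eq_intCast (C : ℤ →+* Lam) a, Int.cast_smul_eq_zsmul]
  have hx' : (T (-1) : Lam) • x = ((u⁻¹ : ℤˣ) : ℤ) • x := by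
    have h : (T (-1) : Lam) • (T 1 : Lam) • x = x := by
      rw [smul_smul, ← T_add, neg_add_cancel, T_zero, one_smul]
    rw [hx, smul_comm] at h
    rw [← h, smul_smul, ← Units.val_mul, inv_mul_cancel, Units.val_one, one_smul, h]
  induction r using LaurentPolynomial.induction_on with
  | h_C a => rw [eval₂_C, hC, RingHom.id_apply]
  | h_add hp hq => rw [add_smul, map_add, add_smul, hp, hq]
  | h_C_mul_T n a h =>
    rw [T_add, ← mul_assoc, mul_smul, hx, smul_comm, h, map_mul _ (_ * _) (T 1), mul_smul,
      eval₂_T, zpow_one, smul_comm]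
  | h_C_mul_T_Z n a h =>
    rw [sub_eq_add_neg, T_add, ← mul_assoc, mul_smul, hx', smul_comm, h,
      map_mul _ (_ * _) (T (-1)), mul_smul, eval₂_T, zpow_neg_one, smul_comm]

end LaurentPolynomial

namespace LinkDiagram

open IsInvolutoryMedial (AddDis move dis)

section

variable {μ : ℕ} (D : LinkDiagram μ)

/-! ### Walking along a component -/

/-- The arc on which a walk continues after a passage. -/
def arcAfter (p : D.Crossing ⊕ D.Crossing) : D.Arc := Quot.mk _ (.inl p)

theorem arcAfter_symm_inl (c : D.Crossing) :
    D.arcAfter (D.next.symm (.inl c)) = D.arcAfter (.inl c) := Quot.sound (.overpass c)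

theorem exists_kappa_eq (i : Fin μ) : ∃ a, D.kappa a = i := by
  by_cases h : ∃ p, D.comp p = i
  · obtain ⟨p, hp⟩ := h
    exact ⟨D.arcAfter p, hp⟩
  · exact ⟨Quot.mk _ (.inr ⟨i, not_exists.1 h⟩), rfl⟩

/-- A property that persists in a walk along a component holds for all arcs of the component. -/
theorem arc_induction {C : D.Arc → Prop}
    (hC : ∀ p, C (D.arcAfter (D.next.symm p)) → C (D.arcAfter p)) {a b : D.Arc}
    (hab : D.kappa a = D.kappa b) (ha : C a) : C b := by
  obtain ⟨p | i, rfl⟩ := Quot.exists_rep a <;> obtain ⟨q | j, rfl⟩ := Quot.exists_rep b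
  -- There are finitely many passages, so walking forward alone reaches the whole component.
  · obtain ⟨n, rfl⟩ := ((D.comp_eq_iff p q).1 hab).exists_nat_pow_eq
    clear hab
    induction n with
    | zero => exact ha
    | succ n ih =>
      refine hC _ ?_
      rwa [pow_succ', Equiv.Perm.mul_apply, Equiv.symm_apply_apply]
  · exact absurd hab (j.2 p)
  · exact absurd hab.symm (i.2 q)
  · obtain rfl : i = j := Subtype.ext hab
    exact ha

/-- The contribution of a passage to the longitude. -/
noncomputable def passageTerm : D.Crossing ⊕ D.Crossing → D.AlexanderModule
  | .inl _ => 0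
  | .inr c => (D.writhe c : ℤ) • (D.gen (D.overArc c) - D.gen (D.b₁ c))

theorem sum_passageTerm (i : Fin μ) : ∑ p with D.comp p = i, D.passageTerm p = D.longitude i := by
  rw [longitude_eq, Finset.sum_filter, Fintype.sum_sum_type]
  simp [passageTerm, underCrossings, kappa_b₁, Finset.sum_filter]

/-- The crossing relation gives (1 - t)(a - b₁) = b₂ - b₁. The writhe turns the step from b₁ to b₂
into the direction of the orientation. -/
theorem smul_passageTerm (p : D.Crossing ⊕ D.Crossing) : (1 - T 1 : Lam) • D.passageTerm p
    = D.gen (D.arcAfter p) - D.gen (D.arcAfter (D.next.symm p)) := by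
  rcases p with c | c
  · rw [arcAfter_symm_inl, sub_self, passageTerm, smul_zero]
  · have h : (1 - T 1 : Lam) • (D.gen (D.overArc c) - D.gen (D.b₁ c))
        = D.gen (D.b₂ c) - D.gen (D.b₁ c) := by
      rw [← gen_crossing]
      module
    rw [passageTerm, smul_comm, h]
    rcases Int.units_eq_one_or (D.writhe c) with hw | hw
    · simp [b₁, b₂, hw, underIn, underOut, arcAfter]
    · have : (-1 : ℤˣ) ≠ 1 := by decide
      simp [b₁, b₂, hw, this, underIn, underOut, arcAfter]

theorem gen_sub_gen_mem [NeZero μ] (a b : D.Arc) : D.gen a - D.gen b ∈ D.kerPhiRed := by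
  rw [LinearMap.mem_ker, map_sub, phiRed_gen, phiRed_gen, sub_self]

theorem passageTerm_mem [NeZero μ] (p : D.Crossing ⊕ D.Crossing) : D.passageTerm p ∈ D.kerPhiRed := by
  rcases p with c | c
  · exact zero_mem _
  · exact zsmul_mem (D.gen_sub_gen_mem _ _) _

/-! ### The action of the Alexander module -/

section Move

variable {D} {g : D.AlexanderModule →ₗ[Lam] AddDis D.IMQ}

/-- As β_{b₁} fixes q_{b₁}, the displacement β_a β_{b₁} takes q_{b₁} to q_{b₂}. At a negative
crossing the walk goes from b₂ to b₁ and the inverse acts. -/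
theorem move_passageTerm
    (hg : ∀ a b, g (D.gen a - D.gen b) = Additive.ofMul (dis (D.invGen a) (D.invGen b)))
    (p : D.Crossing ⊕ D.Crossing) :
    move (g (D.passageTerm p)) (D.invGen (D.arcAfter (D.next.symm p)))
      = D.invGen (D.arcAfter p) := by
  rcases p with c | c
  · rw [arcAfter_symm_inl, passageTerm, map_zero, IsInvolutoryMedial.move_zero]
  · have h : move (g (D.gen (D.overArc c) - D.gen (D.b₁ c))) (D.invGen (D.b₁ c))
        = D.invGen (D.b₂ c) := by
      rw [hg, IsInvolutoryMedial.move_dis, Quandle.fix, invGen_b₂]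
    rcases Int.units_eq_one_or (D.writhe c) with hw | hw
    · simpa [passageTerm, b₁, b₂, hw, underIn, underOut, arcAfter] using h
    · have : (-1 : ℤˣ) ≠ 1 := by decide
      have h2 := IsInvolutoryMedial.move_neg_move (g (D.gen (D.overArc c) - D.gen (D.b₁ c)))
        (D.invGen (D.b₁ c))
      rw [h] at h2
      simpa [passageTerm, b₁, b₂, hw, this, underIn, underOut, arcAfter] using h2

theorem exists_move_eq [NeZero μ]
    (hg : ∀ a b, g (D.gen a - D.gen b) = Additive.ofMul (dis (D.invGen a) (D.invGen b)))
    {a b : D.Arc} (hab : D.kappa a = D.kappa b) :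
    ∃ n ∈ D.kerPhiRed, move (g n) (D.invGen a) = D.invGen b := by
  refine D.arc_induction (C := fun b => ∃ n ∈ D.kerPhiRed, move (g n) (D.invGen a) = D.invGen b)
    ?_ hab ⟨0, zero_mem _, by rw [map_zero, IsInvolutoryMedial.move_zero]⟩
  rintro p ⟨n, hn, h⟩
  refine ⟨D.passageTerm p + n, add_mem (D.passageTerm_mem p) hn, ?_⟩
  rw [map_add, IsInvolutoryMedial.move_add, h, move_passageTerm hg]

/-- A full turn composes all passage terms of the component, whose sum is the longitude, and returns
to the initial arc. A component without passages has longitude 0. -/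
theorem move_longitude
    (hg : ∀ a b, g (D.gen a - D.gen b) = Additive.ofMul (dis (D.invGen a) (D.invGen b)))
    {a : D.Arc} {i : Fin μ} (ha : D.kappa a = i) :
    move (g (D.longitude i)) (D.invGen a) = D.invGen a := by
  rw [← sum_passageTerm]
  obtain ⟨p | j, rfl⟩ := Quot.exists_rep a
  · have hp : p ∈ ({q | D.comp q = i} : Finset _) := by simpa using (show D.comp p = i from ha)
    have hcyc := Equiv.Perm.isCycleOn_fiber D.comp_eq_iff i
    have hwalk (n : ℕ) :
        move (g (∑ j ∈ Finset.range n, D.passageTerm ((D.next ^ (j + 1)) p)))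
          (D.invGen (D.arcAfter p)) = D.invGen (D.arcAfter ((D.next ^ n) p)) := by
      induction n with
      | zero => simp [IsInvolutoryMedial.move_zero]
      | succ n ih =>
        rw [Finset.sum_range_succ_comm, map_add, IsInvolutoryMedial.move_add, ih,
          pow_succ', Equiv.Perm.mul_apply]
        have h := move_passageTerm hg (D.next ((D.next ^ n) p))
        rwa [Equiv.symm_apply_apply] at h
    rw [← hcyc.sum_range_pow_succ hp]
    refine (hwalk _).trans ?_
    rw [hcyc.pow_card_apply hp]
    rfl
  · obtain rfl : j.1 = i := ha
    rw [Finset.filter_false_of_mem fun p _ => j.2 p, Finset.sum_empty, map_zero,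
      IsInvolutoryMedial.move_zero]

end Move

end

section

variable {μ : ℕ} [NeZero μ] (D : LinkDiagram μ)

/-! ### The kernel of `φ_τ` -/

theorem exists_smul_eq_gen_sub_gen {a b : D.Arc} (hab : D.kappa a = D.kappa b) :
    ∃ y ∈ D.kerPhiRed, (1 - T 1 : Lam) • y = D.gen b - D.gen a := by
  refine D.arc_induction (C := fun b => ∃ y ∈ D.kerPhiRed, (1 - T 1 : Lam) • y
    = D.gen b - D.gen a) ?_ hab ⟨0, zero_mem _, by simp⟩
  rintro p ⟨y, hy, h⟩
  refine ⟨D.passageTerm p + y, add_mem (D.passageTerm_mem p) hy, ?_⟩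
  rw [smul_add, h, smul_passageTerm, sub_add_sub_cancel]

/-- The kernel of `φ_τ` is contained in `(1 - t) ker φ_L^red`. -/
theorem exists_smul_eq_of_phiTau_eq_zero {x : D.AlexanderModule} (hx : D.phiTau x = 0) :
    ∃ y ∈ D.kerPhiRed, (1 - T 1 : Lam) • y = x := by
  let W : Submodule Lam D.AlexanderModule :=
    D.kerPhiRed.map (LinearMap.lsmul Lam D.AlexanderModule (1 - T 1))
  choose A hA using D.exists_kappa_eq
  let v (i : Fin μ) : D.AlexanderModule ⧸ W := W.mkQ (D.gen (A i) - D.gen (A 0))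
  have hv (i : Fin μ) (r : Lam) : r • v i = augmentation r • v i := by
    refine LaurentPolynomial.smul_eq_eval₂_smul 1 ?_ r
    rw [Units.val_one, one_smul, ← map_smul, eq_comm, ← sub_eq_zero, ← map_sub]
    refine (Submodule.Quotient.mk_eq_zero W).2 ⟨_, D.gen_sub_gen_mem (A i) (A 0), ?_⟩
    rw [LinearMap.lsmul_apply, sub_smul, one_smul]
  let ψ : TrivialModule {i : Fin μ // i ≠ 0} →ₗ[Lam] D.AlexanderModule ⧸ W :=
    { toFun := fun z => ∑ j, z j • v j.1
      map_add' := fun z w => by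
        rw [← Finset.sum_add_distrib]
        exact Finset.sum_congr rfl fun j _ => add_smul _ _ _
      map_smul' := fun r z => by
        rw [RingHom.id_apply, Finset.smul_sum]
        refine Finset.sum_congr rfl fun j _ => ?_
        rw [smul_comm, hv, smul_smul, mul_comm]
        rfl }
  -- Modulo W, arcs of one component agree and t fixes their differences across components. So the
  -- projection to the quotient factors through φ_τ by this map s.
  let s : AMu μ →ₗ[Lam] D.AlexanderModule ⧸ W :=
    (LinearMap.toSpanSingleton Lam _ (W.mkQ (D.gen (A 0)))).coprod ψ
  have hψ (i : Fin μ) : ψ (fun j => if j.1 = i then 1 else 0) = v i := by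
    change ∑ j : {i : Fin μ // i ≠ 0}, (if j.1 = i then (1 : ℤ) else 0) • v j.1 = v i
    by_cases hi : i = 0
    · subst hi
      rw [Finset.sum_eq_zero fun j _ => by rw [if_neg j.2, zero_smul]]
      simp [v]
    · rw [Finset.sum_eq_single ⟨i, hi⟩ (fun j _ hj => by
        rw [if_neg fun h => hj (Subtype.ext h), zero_smul]) (by simp), if_pos rfl, one_smul]
  have hs : s ∘ₗ D.phiTau = W.mkQ := by
    refine Submodule.linearMap_qext _ (Finsupp.lhom_ext' fun a => LinearMap.ext_ring ?_)
    change s (D.phiTau (D.gen a)) = W.mkQ (D.gen a)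
    rw [phiTau_gen]
    change s (1, _) = _
    rw [LinearMap.coprod_apply, hψ, LinearMap.toSpanSingleton_apply, one_smul, ← map_add,
      add_sub_cancel, eq_comm, ← sub_eq_zero, ← map_sub]
    exact (Submodule.Quotient.mk_eq_zero W).2 (D.exists_smul_eq_gen_sub_gen (hA _))
  have h := LinearMap.congr_fun hs x
  rw [LinearMap.comp_apply, hx, map_zero] at h
  exact (Submodule.Quotient.mk_eq_zero W).1 h.symm

theorem exists_smul_eq_gen_sub_meridian {m : D.AlexanderModule} {a : D.Arc}
    (hm : m ∈ D.meridians (D.kappa a)) :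
    ∃ y ∈ D.kerPhiRed, (1 - T 1 : Lam) • y = D.gen a - m := by
  obtain ⟨b, hb, h⟩ := hm
  refine D.exists_smul_eq_of_phiTau_eq_zero ?_
  rw [map_sub, h, phiTau_gen, phiTau_gen, hb, sub_self]

end

end LinkDiagram

/-! ### Stabilizers in the displacement group -/

namespace IsInvolutoryMedial

variable {P : Type*} [Quandle P] [IsInvolutoryMedial P]

theorem smul_addDis (r : Lam) (d : AddDis P) :
    r • d = LaurentPolynomial.eval₂ (RingHom.id ℤ) (-1 : ℤˣ) r • d := rfl

/-- Λ acts through ℤ, so a stabilizer, being a subgroup, is a submodule. -/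
theorem move_smul_eq_self {d : AddDis P} {x : P} (h : move d x = x) (r : Lam) :
    move (r • d) x = x := by
  let H : AddSubgroup (AddDis P) :=
    { carrier := {d | move d x = x}
      zero_mem' := move_zero x
      add_mem' := fun {d e} hd he => (congrArg (move d) he).trans hd
      neg_mem' := fun {d} hd => (congrArg (move (-d)) hd).symm.trans (move_neg_move d x) }
  rw [smul_addDis]
  exact H.zsmul_mem h _

end IsInvolutoryMedial

/-! ### Translations and shifts in module quandles -/

namespace ModuleQuandle

variable {M I : Type*} [AddCommGroup M] [Module Lam M]
  {N : Submodule Lam M} {m : I → M} {X : I → Submodule Lam M} (h : IsQuandleData N m X)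

theorem mk_act_mk (j i : I) (y x : N) : mk h j y ◃ mk h i x =
    mk h i (diff h j i + (T 1 : Lam) • x + (1 - T 1 : Lam) • y) := rfl

theorem mk_eq_mk_iff {i j : I} {x y : N} :
    mk h i x = mk h j y ↔ i = j ∧ (x : M) - y ∈ X i := by
  constructor
  · intro hxy
    obtain rfl : i = j := congrArg Sigma.fst hxy
    exact ⟨rfl, (Submodule.Quotient.eq ((X i).submoduleOf N)).1 (eq_of_heq (Sigma.mk.inj hxy).2)⟩
  · rintro ⟨rfl, hxy⟩
    exact congrArg (Sigma.mk i) ((Submodule.Quotient.eq ((X i).submoduleOf N)).2 hxy)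

/-- The quandle `Q(N, (m_i), (X_i))` is medial, and it is involutory if `1 + t` annihilates `N`. -/
theorem isInvolutoryMedial (hT : ∀ n : N, (T 1 : Lam) • n = -n) :
    IsInvolutoryMedial (ModuleQuandle N m X h) where
  involutory y x := by
    obtain ⟨i, x, rfl⟩ := exists_mk h x
    obtain ⟨j, y, rfl⟩ := exists_mk h y
    simp only [mk_act_mk]
    congr 1
    simp only [hT]
    abel
  medial w x y z := by
    obtain ⟨i, w, rfl⟩ := exists_mk h w
    obtain ⟨j, x, rfl⟩ := exists_mk h x
    obtain ⟨k, y, rfl⟩ := exists_mk h y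
    obtain ⟨l, z, rfl⟩ := exists_mk h z
    simp only [mk_act_mk]
    congr 1
    apply Subtype.ext
    simp only [diff, Submodule.coe_add, Submodule.coe_smul]
    module

/-- The translation by `n` in each of the groups `N / X_i`. -/
noncomputable def shift (n : N) (x : ModuleQuandle N m X h) : ModuleQuandle N m X h :=
  ⟨x.1, Submodule.Quotient.mk n + x.2⟩

theorem shift_mk (n : N) (i : I) (x : N) : shift h n (mk h i x) = mk h i (n + x) := rfl

theorem shift_zero (x : ModuleQuandle N m X h) : shift h 0 x = x := by
  obtain ⟨i, x, rfl⟩ := exists_mk h x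
  rw [shift_mk, zero_add]

theorem shift_add (n k : N) (x : ModuleQuandle N m X h) :
    shift h (n + k) x = shift h n (shift h k x) := by
  obtain ⟨i, x, rfl⟩ := exists_mk h x
  rw [shift_mk, shift_mk, shift_mk, add_assoc]

/-- The pairs of a displacement of `P` and an element of `N` whose actions are intertwined by
a map. -/
def shiftPairs {P : Type*} [Quandle P] [IsInvolutoryMedial P] (f : P → ModuleQuandle N m X h) :
    AddSubgroup (IsInvolutoryMedial.AddDis P × N) where
  carrier := {u | ∀ x, f (IsInvolutoryMedial.move u.1 x) = shift h u.2 (f x)}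
  zero_mem' x := (shift_zero h _).symm
  add_mem' {u v} hu hv x := by
    change f (IsInvolutoryMedial.move u.1 (IsInvolutoryMedial.move v.1 x))
      = shift h (u.2 + v.2) (f x)
    rw [hu, hv, shift_add]
  neg_mem' {u} hu x := by
    change f (IsInvolutoryMedial.move (-u.1) x) = shift h (-u.2) (f x)
    have h2 := hu (IsInvolutoryMedial.move (-u.1) x)
    rw [← IsInvolutoryMedial.move_add, add_neg_cancel, IsInvolutoryMedial.move_zero] at h2
    rw [h2, ← shift_add, neg_add_cancel, shift_zero]

/-- The translation by `(j, y)` depends on the element `(1 - t) y + m_j` only. -/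
theorem act_eq_shift {j i : I} {y x n : N}
    (hn : (n : M) = ((1 - T 1 : Lam) • (y : M) + m j) - ((1 - T 1 : Lam) • (x : M) + m i)) :
    mk h j y ◃ mk h i x = shift h n (mk h i x) := by
  rw [mk_act_mk, shift_mk]
  congr 1
  apply Subtype.ext
  simp only [diff, Submodule.coe_add, Submodule.coe_smul, hn]
  module

/-- With t = -1, translation by (j, y) sends x in the i-th summand to (1 - t) y + m_j - m_i - x. Two
such reflections compose to a shift in which m_i and the summand no longer appear. -/
theorem act_act_eq_shift (hT : ∀ n : N, (T 1 : Lam) • n = -n) {j k : I} {y z n : N}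
    (hn : (n : M) = ((1 - T 1 : Lam) • (y : M) + m j) - ((1 - T 1 : Lam) • (z : M) + m k))
    (x : ModuleQuandle N m X h) : mk h j y ◃ (mk h k z ◃ x) = shift h n x := by
  obtain ⟨i, x, rfl⟩ := exists_mk h x
  rw [mk_act_mk, mk_act_mk, shift_mk, hT (_ + _), hT x]
  congr 1
  apply Subtype.ext
  simp only [diff, Submodule.coe_add, Submodule.coe_smul, Submodule.coe_neg, hn]
  abel

end ModuleQuandle

/-! ### The homomorphism from `IMQ(L)` to the module quandle -/

namespace LinkDiagram

open IsInvolutoryMedial (AddDis move dis)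

variable {μ : ℕ} [NeZero μ] (D : LinkDiagram μ)

theorem mem_S {x : D.AlexanderModule} :
    x ∈ D.S ↔ ∃ y ∈ D.kerPhiRed, (1 + T 1 : Lam) • y = x :=
  Submodule.mem_smul_pointwise_iff_exists _ _ _

theorem T_one_smul_map_mkQ (n : D.kerPhiRed.map D.S.mkQ) : (T 1 : Lam) • n = -n := by
  obtain ⟨_, n, hn, rfl⟩ := n
  refine Subtype.ext (eq_neg_of_add_eq_zero_right ?_)
  change D.S.mkQ n + (T 1 : Lam) • D.S.mkQ n = 0
  rw [← map_smul, ← map_add]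
  exact (Submodule.Quotient.mk_eq_zero _).2 (D.mem_S.2 ⟨n, hn, by rw [add_smul, one_smul]⟩)

/-- The projection of `ker φ_L^red` onto its image in `M_A^red(L) / S`. -/
noncomputable abbrev toMap : D.kerPhiRed →ₗ[Lam] D.kerPhiRed.map D.S.mkQ :=
  D.S.mkQ.submoduleMap D.kerPhiRed

theorem map_eq_zero_of_mem_S {P : Type*} [Quandle P] [IsInvolutoryMedial P]
    (g : D.AlexanderModule →ₗ[Lam] AddDis P) {x : D.AlexanderModule} (hx : x ∈ D.S) : g x = 0 := by
  obtain ⟨y, -, rfl⟩ := D.mem_S.1 hx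
  rw [map_smul, add_smul, one_smul, IsInvolutoryMedial.T_one_smul, add_neg_cancel]

/-- The arcs generate and all have φ = 1, so subtracting φ(x) times the base arc from x leaves a
combination of differences. -/
theorem kerPhiRed_le_span (a₀ : D.Arc) :
    D.kerPhiRed ≤ Submodule.span Lam (Set.range fun a => D.gen a - D.gen a₀) := by
  have key (x : D.AlexanderModule) :
      x - D.phiRed x • D.gen a₀ ∈ Submodule.span Lam (Set.range fun a => D.gen a - D.gen a₀) := by
    obtain ⟨e, rfl⟩ := Submodule.mkQ_surjective _ x
    induction e using Finsupp.induction_linear with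
    | zero => simp
    | add x y hx hy =>
      rw [map_add, map_add, add_smul, add_sub_add_comm]
      exact add_mem hx hy
    | single a r =>
      have h : D.sigma (Finsupp.single a r) = r • D.gen a := by
        rw [gen, ← map_smul, Finsupp.smul_single, smul_eq_mul, mul_one]
      rw [h, map_smul, phiRed_gen, smul_eq_mul, mul_one, ← smul_sub]
      exact Submodule.smul_mem _ _ (Submodule.subset_span ⟨a, rfl⟩)
  intro x hx
  have h := key x
  rwa [LinearMap.mem_ker.1 hx, zero_smul, sub_zero] at h

section

variable {m : Fin μ → D.AlexanderModule} (hm : ∀ i, m i ∈ D.meridians i)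

/-- The quandle that is isomorphic to `IMQ(L)`. -/
abbrev InvModuleQuandle : Type :=
  ModuleQuandle (D.kerPhiRed.map D.S.mkQ) (fun i => D.S.mkQ (m i))
    (fun i => (D.longitudeModule i).map D.S.mkQ) ((D.isQuandleData hm).map_mkQ D.S)

instance : IsInvolutoryMedial (D.InvModuleQuandle hm) :=
  ModuleQuandle.isInvolutoryMedial _ D.T_one_smul_map_mkQ

/-- The elements `(κ(a), n)` of the quandle which can be the image of `q_a`. -/
def IsArcImage (a : D.Arc) (x : D.InvModuleQuandle hm) : Prop :=
  ∃ n, x = ModuleQuandle.mk _ (D.kappa a) n ∧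
    (1 - T 1 : Lam) • (n : D.AlexanderModule ⧸ D.S) = D.S.mkQ (D.gen a - m (D.kappa a))

variable {hm} in
-- The condition on n says that (1 - t) n + m_κ(a) is the class of a, and translations depend on
-- this element only.
theorem IsArcImage.act_eq_shift {a b : D.Arc} {x y : D.InvModuleQuandle hm}
    (hx : D.IsArcImage hm a x) (hy : D.IsArcImage hm b y) :
    x ◃ y = ModuleQuandle.shift _ (D.toMap ⟨_, D.gen_sub_gen_mem a b⟩) y := by
  obtain ⟨x, rfl, hx⟩ := hx
  obtain ⟨y, rfl, hy⟩ := hy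
  refine ModuleQuandle.act_eq_shift _ ?_
  rw [hx, hy, ← map_add, ← map_add, sub_add_cancel, sub_add_cancel]
  exact map_sub D.S.mkQ _ _

variable {hm} in
theorem IsArcImage.act_act_eq_shift {a b : D.Arc} {x y : D.InvModuleQuandle hm}
    (hx : D.IsArcImage hm a x) (hy : D.IsArcImage hm b y) (z : D.InvModuleQuandle hm) :
    x ◃ (y ◃ z) = ModuleQuandle.shift _ (D.toMap ⟨_, D.gen_sub_gen_mem a b⟩) z := by
  obtain ⟨x, rfl, hx⟩ := hx
  obtain ⟨y, rfl, hy⟩ := hy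
  refine ModuleQuandle.act_act_eq_shift _ D.T_one_smul_map_mkQ ?_ z
  rw [hx, hy, ← map_add, ← map_add, sub_add_cancel, sub_add_cancel]
  exact map_sub D.S.mkQ _ _

theorem exists_isArcImage : ∃ φ : D.Arc → D.InvModuleQuandle hm,
    (∀ a, D.IsArcImage hm a (φ a)) ∧ ∀ c, φ (D.b₂ c) = φ (D.overArc c) ◃ φ (D.b₁ c) := by
  have hbase (a : D.Arc) : ∃ n : D.kerPhiRed.map D.S.mkQ,
      (1 - T 1 : Lam) • (n : D.AlexanderModule ⧸ D.S) = D.S.mkQ (D.gen a - m (D.kappa a)) := by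
    obtain ⟨y, hy, h⟩ := D.exists_smul_eq_gen_sub_meridian (hm (D.kappa a))
    exact ⟨⟨_, y, hy, rfl⟩, by rw [← h, map_smul]⟩
  let δ (p : D.Crossing ⊕ D.Crossing) : D.kerPhiRed.map D.S.mkQ :=
    D.toMap ⟨D.passageTerm p, D.passageTerm_mem p⟩
  -- The passage terms of a component add up to its longitude, which lies in X_i. The condition (1 -
  -- t) n = a - m survives each step by `smul_passageTerm`.
  obtain ⟨ν, hν, hνδ⟩ := exists_potential D.comp_eq_iff
    (fun i => (((D.longitudeModule i).map D.S.mkQ).submoduleOf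
      (D.kerPhiRed.map D.S.mkQ)).toAddSubgroup) δ
    (fun i => by
      refine ⟨D.longitude i, Submodule.mem_span_singleton_self _, ?_⟩
      rw [← sum_passageTerm]
      simp [δ])
    (fun p n => (1 - T 1 : Lam) • (n : D.AlexanderModule ⧸ D.S)
      = D.S.mkQ (D.gen (D.arcAfter p) - m (D.comp p)))
    (fun p => hbase (D.arcAfter p))
    (fun p n hn => by
      have h := D.smul_passageTerm (D.next p)
      rw [Equiv.symm_apply_apply] at h
      change (1 - T 1 : Lam) • ((n : D.AlexanderModule ⧸ D.S) + D.S.mkQ (D.passageTerm _)) = _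
      rw [smul_add, hn, ← map_smul, h, ← map_add, comp_next]
      congr 1
      abel)
  choose n₀ hn₀ using hbase
  let φ₀ : D.Edge → D.InvModuleQuandle hm
    | .inl p => ModuleQuandle.mk _ (D.comp p) (ν p)
    | .inr i => ModuleQuandle.mk _ i.1 (n₀ (Quot.mk _ (.inr i)))
  have hφ₀ (p : D.Crossing ⊕ D.Crossing) : φ₀ (.inl p)
      = ModuleQuandle.shift _ (δ p) (φ₀ (.inl (D.next.symm p))) := by
    have h := hνδ (D.next.symm p)
    rw [Equiv.apply_symm_apply, add_comm, comp_next_symm] at h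
    exact (ModuleQuandle.mk_eq_mk_iff _).2 ⟨(D.comp_next_symm p).symm, h⟩
  -- Overpasses contribute 0, so the value is constant on arcs.
  let φ : D.Arc → D.InvModuleQuandle hm := Quot.lift φ₀ <| by
    rintro _ _ ⟨c⟩
    have h0 : δ (.inl c) = 0 := D.toMap.map_zero
    rw [hφ₀ (.inl c), h0, ModuleQuandle.shift_zero]
  have hφ (a : D.Arc) : D.IsArcImage hm a (φ a) := by
    obtain ⟨p | i, rfl⟩ := Quot.exists_rep a
    · exact ⟨ν p, rfl, hν p⟩
    · exact ⟨_, rfl, hn₀ _⟩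
  refine ⟨φ, hφ, fun c => ?_⟩
  rw [(hφ _).act_eq_shift D (hφ _)]
  have h : φ (D.underOut c) = ModuleQuandle.shift _ (δ (.inr c)) (φ (D.underIn c)) :=
    hφ₀ (.inr c)
  have hδ : δ (.inr c) = (D.writhe c : ℤ) • D.toMap ⟨_, D.gen_sub_gen_mem (D.overArc c) (D.b₁ c)⟩ :=
    map_zsmul D.toMap (D.writhe c : ℤ) ⟨_, D.gen_sub_gen_mem (D.overArc c) (D.b₁ c)⟩
  rw [hδ] at h
  rcases Int.units_eq_one_or (D.writhe c) with hw | hw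
  · simpa [b₁, b₂, hw] using h
  · have hne : (-1 : ℤˣ) ≠ 1 := by decide
    have h1 : D.b₁ c = D.underOut c := by simp [b₁, hw, hne]
    have h2 : D.b₂ c = D.underIn c := by simp [b₂, hw, hne]
    rw [hw, Units.val_neg, Units.val_one, neg_smul, one_smul, ← h1, ← h2] at h
    rw [h, ← ModuleQuandle.shift_add, add_neg_cancel, ModuleQuandle.shift_zero]

variable {hm} in
-- Intertwined pairs form a subgroup, and Λ acts on both sides through ℤ with t = -1. So differences
-- of arcs suffice, and these act on both sides as products of two translations.
theorem map_move_eq_shift {f : D.IMQ →◃ D.InvModuleQuandle hm}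
    (hf : ∀ a, D.IsArcImage hm a (f (D.invGen a)))
    {g : D.AlexanderModule →ₗ[Lam] AddDis D.IMQ}
    (hg : ∀ a b, g (D.gen a - D.gen b) = Additive.ofMul (dis (D.invGen a) (D.invGen b)))
    (n : D.kerPhiRed) (x : D.IMQ) :
    f (move (g n) x) = ModuleQuandle.shift _ (D.toMap n) (f x) := by
  let H := ModuleQuandle.shiftPairs ((D.isQuandleData hm).map_mkQ D.S) f
  obtain ⟨a₀, -⟩ := D.exists_kappa_eq 0
  suffices h : ∀ n ∈ Submodule.span Lam (Set.range fun a => D.gen a - D.gen a₀),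
      ∃ hn : n ∈ D.kerPhiRed, (g n, D.toMap ⟨n, hn⟩) ∈ H from
    (h n (D.kerPhiRed_le_span a₀ n.2)).2 x
  intro n hn
  induction hn using Submodule.span_induction with
  | mem n hn =>
    obtain ⟨a, rfl⟩ := hn
    refine ⟨D.gen_sub_gen_mem a a₀, fun x => ?_⟩
    rw [hg, IsInvolutoryMedial.move_dis, ShelfHom.map_act, ShelfHom.map_act]
    exact (hf a).act_act_eq_shift D (hf a₀) _
  | zero =>
    have h : (g 0, D.toMap 0) = 0 := Prod.ext (map_zero g) (map_zero D.toMap)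
    exact ⟨zero_mem _, h ▸ H.zero_mem⟩
  | add n k _ _ ihn ihk =>
    obtain ⟨⟨hn, hn'⟩, ⟨hk, hk'⟩⟩ := And.intro ihn ihk
    have h : (g (n + k), D.toMap (⟨n, hn⟩ + ⟨k, hk⟩))
        = (g n, D.toMap ⟨n, hn⟩) + (g k, D.toMap ⟨k, hk⟩) :=
      Prod.ext (map_add g n k) (map_add D.toMap _ _)
    exact ⟨add_mem hn hk, h ▸ H.add_mem hn' hk'⟩
  | smul r n _ ih =>
    obtain ⟨hn, hn'⟩ := ih
    have h : (g (r • n), D.toMap (r • ⟨n, hn⟩))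
        = LaurentPolynomial.eval₂ (RingHom.id ℤ) (-1 : ℤˣ) r • (g n, D.toMap ⟨n, hn⟩) := by
      refine Prod.ext (map_smul g r n) ((map_smul D.toMap r _).trans ?_)
      refine LaurentPolynomial.smul_eq_eval₂_smul (-1) ?_ r
      rw [T_one_smul_map_mkQ, Units.val_neg, Units.val_one, neg_smul, one_smul]
    exact ⟨Submodule.smul_mem _ r hn, h ▸ H.zsmul_mem hn' _⟩

end

theorem exists_eq_move {g : D.AlexanderModule →ₗ[Lam] AddDis D.IMQ}
    (hg : ∀ a b, g (D.gen a - D.gen b) = Additive.ofMul (dis (D.invGen a) (D.invGen b)))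
    (x : D.IMQ) : ∃ (a : D.Arc) (n : D.kerPhiRed), x = move (g n) (D.invGen a) := by
  induction x using D.imq_induction_on with
  | gen a => exact ⟨a, 0, by rw [Submodule.coe_zero, map_zero, IsInvolutoryMedial.move_zero]⟩
  | act x y hx hy =>
    obtain ⟨⟨a, n, rfl⟩, ⟨b, k, rfl⟩⟩ := And.intro hx hy
    -- The translation by d q_a is d² β_a, β_a inverts the displacement of q_b, and β_a q_b = β_a
    -- β_b q_b.
    refine ⟨b, (2 : ℤ) • n + (-k + ⟨_, D.gen_sub_gen_mem a b⟩), ?_⟩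
    rw [IsInvolutoryMedial.move_act, IsInvolutoryMedial.act_move]
    simp only [Submodule.coe_add, Submodule.coe_neg, map_add, map_neg, hg,
      IsInvolutoryMedial.move_add, IsInvolutoryMedial.move_dis, Quandle.fix]
    rw [← map_zsmul]
    rfl

end LinkDiagram

/-! ### The isomorphism -/

theorem mainTheorem6 {μ : ℕ} [NeZero μ] (D : LinkDiagram μ)
    (m : Fin μ → D.AlexanderModule) (hm : ∀ i, m i ∈ D.meridians i) :
    ∃ f : D.IMQ →◃ ModuleQuandle (D.kerPhiRed.map D.S.mkQ) (fun i => D.S.mkQ (m i))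
        (fun i => (D.longitudeModule i).map D.S.mkQ) ((D.isQuandleData hm).map_mkQ D.S),
      Function.Bijective f := by
  obtain ⟨φ, hφ, hcross⟩ := D.exists_isArcImage hm
  obtain ⟨f, hfφ⟩ := D.exists_imq_hom φ hcross
  have hf (a : D.Arc) : D.IsArcImage hm a (f (D.invGen a)) := hfφ a ▸ hφ a
  obtain ⟨a₀, -⟩ := D.exists_kappa_eq 0
  obtain ⟨g, hg⟩ := D.exists_toDis a₀
  refine ⟨f, fun x y hxy => ?_, fun x => ?_⟩
  · obtain ⟨a, n, rfl⟩ := D.exists_eq_move hg x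
    obtain ⟨b, k, rfl⟩ := D.exists_eq_move hg y
    have hab : D.kappa a = D.kappa b := by
      rw [D.map_move_eq_shift hf hg, D.map_move_eq_shift hf hg] at hxy
      obtain ⟨⟨s, hs, -⟩, ⟨t, ht, -⟩⟩ := And.intro (hf a) (hf b)
      rw [hs, ht] at hxy
      exact congrArg Sigma.fst hxy
    -- Both elements are now displacements of the same generator q_a.
    obtain ⟨l, hl, hlb⟩ := LinkDiagram.exists_move_eq hg hab
    rw [← hlb, ← IsInvolutoryMedial.move_add, ← map_add] at hxy ⊢
    rw [D.map_move_eq_shift hf hg, ← Submodule.coe_mk l hl, ← Submodule.coe_add,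
      D.map_move_eq_shift hf hg] at hxy
    obtain ⟨s, hs, -⟩ := hf a
    rw [hs, ModuleQuandle.shift_mk, ModuleQuandle.shift_mk, ModuleQuandle.mk_eq_mk_iff] at hxy
    obtain ⟨-, z, hz, hzn⟩ := hxy
    obtain ⟨r, rfl⟩ := Submodule.mem_span_singleton.1 hz
    -- Equal images mean that the displacements differ by a multiple of the longitude modulo S; g
    -- kills S and the longitude fixes q_a.
    have hS : (n : D.AlexanderModule) - (k + l) - r • D.longitude (D.kappa a) ∈ D.S := by
      refine (Submodule.Quotient.mk_eq_zero _).1 ?_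
      change D.S.mkQ _ = 0
      rw [map_sub, hzn, Submodule.coe_add, Submodule.coe_add, add_sub_add_right_eq_sub]
      change D.S.mkQ ((n : D.AlexanderModule) - (k + l)) - (D.S.mkQ n - D.S.mkQ (k + l)) = 0
      rw [map_sub, sub_self]
    have h0 := D.map_eq_zero_of_mem_S g hS
    rw [map_sub, map_sub, map_smul, sub_sub, sub_eq_zero] at h0
    rw [h0, IsInvolutoryMedial.move_add,
      IsInvolutoryMedial.move_smul_eq_self (LinkDiagram.move_longitude hg rfl)]
  · obtain ⟨i, x, rfl⟩ := ModuleQuandle.exists_mk _ x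
    obtain ⟨a, rfl⟩ := D.exists_kappa_eq i
    obtain ⟨s, hs, -⟩ := hf a
    obtain ⟨n, hn⟩ := D.S.mkQ.submoduleMap_surjective D.kerPhiRed (x - s)
    refine ⟨IsInvolutoryMedial.move (g n) (D.invGen a), ?_⟩
    rw [D.map_move_eq_shift hf hg, hn, hs, ModuleQuandle.shift_mk, sub_add_cancel]
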